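/- **Conventions.** An *adic ring* is a commutative topological ring $A$ that has a finitely generated ideal of definition $I$ (the topology is the $I$-adic one) and is $I$-adically complete and separated, $A\cong\lim_n A/I^{n+1}$. Morphisms of adic rings are continuous ring homomorphisms; a morphism $\varphi:A\to B$ is *adic* if $\varphi(I)B$ is an ideal of definition of $B$ for every (equivalently, for one) ideal of definition $I$ of $A$. An adic morphism is *of formal finite presentation* if $A/I^{n+1}\to B/(IB)^{n+1}$ is of finite presentation for all $n\in\mathbb N$ and every (equivalently, for one) ideal of definition $I$ of $A$. A *thickening of adic rings* is a surjective adic morphism of adic rings whose kernel consists of topologically nilpotent elements. The *affine infinitesimal neighbourhood* of a surjective adic morphism $\varphi:A\to B$ of adic rings is a factorisation $A\xrightarrow{\iota}\hat A_\varphi\xrightarrow{\hat\varphi}B$ of $\varphi$ by morphisms of adic rings such that $\hat\varphi$ is a thickening of adic rings and such that for every thickening of adic rings $\varphi':C'\to C$ and all morphisms of adic rings $\psi:A\to C'$ and $\psi':B\to C$ with $\varphi'\circ\psi=\psi'\circ\varphi$ there is a unique morphism of adic rings $\theta:\hat A_\varphi\to C'$ with $\theta\circ\iota=\psi$ and $\varphi'\circ\theta=\psi'\circ\hat\varphi$.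 **Proposition.** Let $\varphi:A\to B$ be a surjective adic morphism of adic rings of formal finite presentation. Let $I$ be an ideal of definition of $A$ and let $K:=\ker\varphi$. Let $$\hat A_\varphi:=\lim_{n\in\mathbb N}A/(I+K)^{n+1}$$ with the limit topology (each $A/(I+K)^{n+1}$ being discrete), let $\iota:A\to\hat A_\varphi$ be the canonical map, and let $\hat\varphi:\hat A_\varphi\to B=\lim_n B/(IB)^{n+1}$ be the limit of the maps $A/(I+K)^{n+1}\to B/(IB)^{n+1}$ induced by $\varphi$. Then $\hat\varphi$ is of formal finite presentation, and $A\xrightarrow{\iota}\hat A_\varphi\xrightarrow{\hat\varphi}B$ is the affine infinitesimal neighbourhood of $\varphi$; in particular $\hat\varphi$ is a thickening of adic rings. -/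

import Mathlib

universe u v w w₁ w₂

open Topology

/-- An adic ring: a commutative topological ring which has a finitely generated ideal of definition
`I` (i.e. the topology is the `I`-adic one) and is `I`-adically complete and separated, that is
`A ≃ lim A / I ^ n`. -/
structure IsAdicRing (A : Type u) [CommRing A] [TopologicalSpace A] : Prop where
  exists_ideal : ∃ I : Ideal A, I.FG ∧ IsAdic I ∧ IsAdicComplete I A

/-- Completeness does not depend on the ideal of definition. -/
theorem IsAdicRing.isAdicComplete {A : Type u} [CommRing A] [TopologicalSpace A]
    (hA : IsAdicRing A) {J : Ideal A} (hJ : IsAdic J) : IsAdicComplete J A := by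
  obtain ⟨I, -, hI, hc⟩ := hA.exists_ideal
  have h0 : @NonarchimedeanRing A _ I.adicTopology := I.nonarchimedean
  rw [← (show _ = I.adicTopology from hI)] at h0
  let _ : UniformSpace A := IsTopologicalAddGroup.rightUniformSpace A
  have : IsUniformAddGroup A := isUniformAddGroup_of_addCommGroup
  exact hJ.isAdicComplete_iff.mpr (hI.isAdicComplete_iff.mp hc)

/-- An adic morphism: a continuous ring homomorphism `φ : A → B` such that `φ(I) B` is an ideal of
definition of `B` for every (equivalently, for one) ideal of definition `I` of `A`. -/
structure IsAdicHom {A : Type u} {B : Type v} [CommRing A] [TopologicalSpace A] [CommRing B]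
    [TopologicalSpace B] (φ : A →+* B) : Prop where
  continuous : Continuous φ
  isAdic_map : ∀ I : Ideal A, IsAdic I → IsAdic (I.map φ)

/-- The morphism `A / I ^ n → B / (I B) ^ n` induced by `φ : A → B`. -/
noncomputable def reductionMap {A : Type u} {B : Type v} [CommRing A] [CommRing B] (φ : A →+* B) (I : Ideal A)
    (n : ℕ) : A ⧸ I ^ n →+* B ⧸ (I.map φ) ^ n :=
  Ideal.quotientMap ((I.map φ) ^ n) φ (by
    rw [← Ideal.map_le_iff_le_comap, Ideal.map_pow])

/-- An adic morphism `φ : A → B` is of formal finite presentation if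
`A / I ^ (n + 1) → B / (I B) ^ (n + 1)` is of finite presentation for all `n` and every
(equivalently, by base change, for one) ideal of definition `I` of `A`. -/
structure IsOfFormalFinitePresentation {A : Type u} {B : Type v} [CommRing A] [TopologicalSpace A]
    [CommRing B] [TopologicalSpace B] (φ : A →+* B) : Prop extends IsAdicHom φ where
  finitePresentation : ∀ I : Ideal A, IsAdic I → ∀ n : ℕ,
    (reductionMap φ I (n + 1)).FinitePresentation

/-- A thickening of adic rings: a surjective adic morphism of adic rings whose kernel consists of
topologically nilpotent elements. For an ideal of definition `I` of `C'`, the last condition says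
that `ker φ' ≤ √I`, equivalently that `C' / I ^ (n + 1) → C / (I C) ^ (n + 1)` has locally nilpotent
kernel for all `n`. For discrete rings it says that `ker φ'` is locally nilpotent. -/
structure IsThickening {C' : Type w₁} {C : Type w₂} [CommRing C'] [TopologicalSpace C']
    [CommRing C] [TopologicalSpace C] (φ' : C' →+* C) : Prop extends IsAdicHom φ' where
  isAdicRing_source : IsAdicRing C'
  isAdicRing_target : IsAdicRing C
  surjective : Function.Surjective φ'
  isTopologicallyNilpotent : ∀ x ∈ RingHom.ker φ', IsTopologicallyNilpotent x

/-- `A → E → B`, given by `ι` and `φhat`, is the affine infinitesimal neighbourhood of the morphism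
of adic rings `φ : A → B`: it is a factorisation of `φ` by morphisms of adic rings (continuous ring
homomorphisms), `φhat` is a thickening, and for every thickening `φ' : C' → C` and all morphisms
`ψ : A → C'`, `ψ' : B → C` with `φ' ψ = ψ' φ` there is a unique morphism `θ : E → C'` with
`θ ι = ψ` and `φ' θ = ψ' φhat`. -/
structure IsAffineInfinitesimalNeighbourhood {A : Type u} {B : Type v} {E : Type w}
    [CommRing A] [TopologicalSpace A] [CommRing B] [TopologicalSpace B]
    [CommRing E] [TopologicalSpace E]
    (φ : A →+* B) (ι : A →+* E) (φhat : E →+* B) : Prop where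
  continuous_ι : Continuous ι
  isThickening : IsThickening φhat
  fac : φhat.comp ι = φ
  existsUnique : ∀ (C' : Type w₁) (C : Type w₂) [CommRing C'] [TopologicalSpace C']
    [CommRing C] [TopologicalSpace C] (φ' : C' →+* C), IsThickening φ' →
    ∀ (ψ : A →+* C') (ψ' : B →+* C), Continuous ψ → Continuous ψ' → φ'.comp ψ = ψ'.comp φ →
    ∃! θ : E →+* C', Continuous θ ∧ θ.comp ι = ψ ∧ φ'.comp θ = ψ'.comp φhat

/-- The limit topology on the adic completion `lim A / J ^ n`, where each `A / J ^ n` is discrete: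
the coarsest topology for which all projections to the discrete rings `A / J ^ n` are continuous. -/
noncomputable instance adicCompletionLimitTopology {A : Type u} [CommRing A] (J : Ideal A) :
    TopologicalSpace (AdicCompletion J A) :=
  ⨅ n : ℕ, TopologicalSpace.induced (AdicCompletion.evalₐ J n) ⊥

theorem sup_ker_pow_le_comap {A : Type u} {B : Type v} [CommRing A] [CommRing B] (φ : A →+* B)
    (I : Ideal A) (n : ℕ) : (I ⊔ RingHom.ker φ) ^ n ≤ ((I.map φ) ^ n).comap φ := by
  have h : (I ⊔ RingHom.ker φ).map φ = I.map φ := by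
    rw [Ideal.map_sup, (Ideal.map_eq_bot_iff_le_ker φ).mpr le_rfl, sup_bot_eq]
  rw [← Ideal.map_le_iff_le_comap, Ideal.map_pow, h]

/-- For `K = ker φ`, the composite `lim A / (I + K) ^ m → A / (I + K) ^ n → B / (I B) ^ n` of the
projection and the morphism induced by `φ`. -/
noncomputable def infinitesimalNeighbourhoodLevelMap {A : Type u} {B : Type v} [CommRing A]
    [CommRing B] (φ : A →+* B) (I : Ideal A) (n : ℕ) :
    AdicCompletion (I ⊔ RingHom.ker φ) A →+* B ⧸ (I.map φ) ^ n :=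
  (Ideal.quotientMap ((I.map φ) ^ n) φ (sup_ker_pow_le_comap φ I n)).comp
    (AdicCompletion.evalₐ (I ⊔ RingHom.ker φ) n : _ →+* A ⧸ (I ⊔ RingHom.ker φ) ^ n)

theorem factorPow_comp_infinitesimalNeighbourhoodLevelMap {A : Type u} {B : Type v} [CommRing A]
    [CommRing B] (φ : A →+* B) (I : Ideal A) {m n : ℕ} (hle : m ≤ n) :
    (Ideal.Quotient.factorPow (I.map φ) hle).comp (infinitesimalNeighbourhoodLevelMap φ I n) =
      infinitesimalNeighbourhoodLevelMap φ I m := by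
  ext x
  obtain ⟨f, rfl⟩ := AdicCompletion.mk_surjective _ _ x
  have h := congrArg
    (Ideal.quotientMap ((I.map φ) ^ m) φ (sup_ker_pow_le_comap φ I m))
    (AdicCompletion.Ideal.mk_eq_mk (I ⊔ RingHom.ker φ) hle f)
  simp only [Ideal.quotientMap_mk] at h
  simp only [infinitesimalNeighbourhoodLevelMap, RingHom.comp_apply, RingHom.coe_coe,
    AdicCompletion.evalₐ_mk, Ideal.quotientMap_mk]
  exact h

/-- For `K = ker φ`, the morphism `lim A / (I + K) ^ n → B = lim B / (I B) ^ n`, obtained as the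
limit of the morphisms `A / (I + K) ^ n → B / (I B) ^ n` induced by `φ`. -/
noncomputable def infinitesimalNeighbourhoodMap {A : Type u} {B : Type v} [CommRing A]
    [TopologicalSpace A] [CommRing B] [TopologicalSpace B] (hB : IsAdicRing B) (φ : A →+* B)
    (hφ : IsAdicHom φ) (I : Ideal A) (hI : IsAdic I) :
    AdicCompletion (I ⊔ RingHom.ker φ) A →+* B :=
  haveI : IsAdicComplete (I.map φ) B := hB.isAdicComplete (hφ.isAdic_map I hI)
  IsAdicComplete.liftRingHom (I.map φ) (infinitesimalNeighbourhoodLevelMap φ I)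
    (factorPow_comp_infinitesimalNeighbourhoodLevelMap φ I)

/-! Write `K = ker φ`. The given `I` need not be finitely generated, so a finitely generated ideal
of definition `I₀` is used beside it. Finite presentation of the reductions of `φ` makes every `K +
I₀ ^ (k + 1)` finitely generated, in particular `I₀ + K`, though perhaps not `K`. The powers of `I +
K` and `I₀ + K` are cofinal, so the completion `E` is also the one at `I₀ + K`; there finite
generation makes `E` an adic ring with ideal of definition `F = (I₀ + K)E`.

The rest uses density of `A` in `E`. Approximating an element of `ker φhat` by one of `A` gives `ker
φhat ≤ (K + (I₀ + K) ^ k)E` (`ker_le_map_sup`): `k = 1` yields the thickening, large `k` the finite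
presentation. For the universal property, `ψ` sends `I₀ + K` to topologically nilpotent elements, so
by finite generation some power lands in an ideal of definition of `C'`; then `ψ` extends to `E` by
completeness, and density gives both uniqueness and the compatibility with `φhat`. -/

section IsAdic

/-! ### Ideals of definition, continuity and adic morphisms. -/

variable {R : Type u} [CommRing R] [TopologicalSpace R] {S : Type v} [CommRing S]
  [TopologicalSpace S]

theorem IsAdic.isTopologicalRing {I : Ideal R} (hI : IsAdic I) : IsTopologicalRing R := by
  have h0 : @NonarchimedeanRing R _ I.adicTopology := I.nonarchimedean
  rw [← (show _ = I.adicTopology from hI)] at h0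
  infer_instance

theorem IsAdic.mem_nhds_zero {I : Ideal R} (hI : IsAdic I) (n : ℕ) :
    ((I ^ n : Ideal R) : Set R) ∈ 𝓝 (0 : R) :=
  hI.hasBasis_nhds_zero.mem_of_mem trivial

theorem IsAdic.exists_pow_le_comap {I : Ideal R} (hI : IsAdic I) {J : Ideal S} (hJ : IsAdic J)
    {f : R →+* S} (hf : Continuous f) : ∃ m : ℕ, I ^ m ≤ J.comap f := by
  have h : (J : Set S) ∈ 𝓝 (f 0) := by
    simpa using hJ.mem_nhds_zero 1
  obtain ⟨m, -, hm⟩ := hI.hasBasis_nhds_zero.mem_iff.mp (hf.continuousAt h)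
  exact ⟨m, hm⟩

theorem IsAdic.exists_pow_le {I : Ideal R} (hI : IsAdic I) {J : Ideal R} (hJ : IsAdic J) :
    ∃ m : ℕ, I ^ m ≤ J := by
  simpa using hI.exists_pow_le_comap hJ (f := RingHom.id R) continuous_id

theorem IsAdic.continuous_of_pow_le_comap {I : Ideal R} (hI : IsAdic I) {J : Ideal S}
    (hJ : IsAdic J) {f : R →+* S} {m : ℕ} (h : I ^ m ≤ J.comap f) : Continuous f := by
  have := hI.isTopologicalRing
  have := hJ.isTopologicalRing
  refine continuous_of_continuousAt_zero f ?_
  rw [ContinuousAt, map_zero]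
  refine hI.hasBasis_nhds_zero.tendsto_iff hJ.hasBasis_nhds_zero |>.mpr fun n _ ↦
    ⟨m * n, trivial, fun x hx ↦ ?_⟩
  have h' : I ^ (m * n) ≤ (J ^ n).comap f := by
    rw [pow_mul]
    exact (Ideal.pow_right_mono h n).trans (Ideal.le_comap_pow f n)
  exact h' hx

theorem IsAdic.of_pow_le_of_pow_le {I J : Ideal R} (hI : IsAdic I) {m n : ℕ} (hm : I ^ m ≤ J)
    (hn : J ^ n ≤ I) : IsAdic J := by
  have := hI.isTopologicalRing
  refine isAdic_iff.mpr ⟨fun k ↦ ?_, fun s hs ↦ ?_⟩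
  · refine (J ^ k).toAddSubgroup.isOpen_of_mem_nhds (g := 0) (Filter.mem_of_superset
      (hI.mem_nhds_zero (m * k)) ?_)
    rw [pow_mul]
    exact Ideal.pow_right_mono hm k
  · obtain ⟨k, -, hk⟩ := hI.hasBasis_nhds_zero.mem_iff.mp hs
    refine ⟨n * k, subset_trans ?_ hk⟩
    rw [pow_mul]
    exact Ideal.pow_right_mono hn k

theorem IsAdic.isTopologicallyNilpotent {I : Ideal R} (hI : IsAdic I) {x : R} (hx : x ∈ I) :
    IsTopologicallyNilpotent x := by
  refine hI.hasBasis_nhds_zero.tendsto_right_iff.mpr fun n _ ↦ ?_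
  filter_upwards [Filter.eventually_ge_atTop n] with k hk
  exact Ideal.pow_le_pow_right hk (Ideal.pow_mem_pow hx k)

/-- A ring homomorphism which maps one ideal of definition to an ideal of definition is adic. -/
theorem IsAdicHom.of_isAdic_map {f : R →+* S} {I : Ideal R} (hI : IsAdic I)
    (h : IsAdic (I.map f)) : IsAdicHom f where
  continuous := hI.continuous_of_pow_le_comap h (m := 1) (by
    rw [pow_one]
    exact Ideal.le_comap_map)
  isAdic_map L hL := by
    obtain ⟨m, hm⟩ := hI.exists_pow_le hL
    obtain ⟨n, hn⟩ := hL.exists_pow_le hI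
    refine h.of_pow_le_of_pow_le (m := m) (n := n) ?_ ?_
    · rw [← Ideal.map_pow]
      exact Ideal.map_mono hm
    · rw [← Ideal.map_pow]
      exact Ideal.map_mono hn

end IsAdic

/-! ### Finite presentation of reductions of a surjection. -/

section Reduction

variable {A : Type u} {B : Type v} [CommRing A] [CommRing B] {φ : A →+* B} {I : Ideal A} {n : ℕ}

theorem ker_mk_map_pow_comp (hφ : Function.Surjective φ) :
    RingHom.ker ((Ideal.Quotient.mk ((I.map φ) ^ n)).comp φ) = RingHom.ker φ ⊔ I ^ n := by
  rw [← RingHom.comap_ker, Ideal.mk_ker, ← Ideal.map_pow, Ideal.comap_map_of_surjective' φ hφ,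
    sup_comm]

theorem reductionMap_comp_mk :
    (reductionMap φ I n).comp (Ideal.Quotient.mk (I ^ n)) =
      (Ideal.Quotient.mk ((I.map φ) ^ n)).comp φ := by
  ext x
  simp [reductionMap]

theorem comap_mk_ker_reductionMap (hφ : Function.Surjective φ) :
    (RingHom.ker (reductionMap φ I n)).comap (Ideal.Quotient.mk (I ^ n)) =
      RingHom.ker φ ⊔ I ^ n := by
  rw [RingHom.comap_ker, reductionMap_comp_mk, ker_mk_map_pow_comp hφ]

theorem reductionMap_surjective (hφ : Function.Surjective φ) :
    Function.Surjective (reductionMap φ I n) := by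
  refine Function.Surjective.of_comp (g := Ideal.Quotient.mk (I ^ n)) ?_
  rw [← RingHom.coe_comp, reductionMap_comp_mk]
  exact Ideal.Quotient.mk_surjective.comp hφ

/-- The ideal is the kernel of the surjection `A → B / (I B) ^ n`, which is finitely presented as a
composite through `A / I ^ n`. -/
theorem fg_ker_sup_pow_of_finitePresentation (hφ : Function.Surjective φ) (hI : I.FG)
    (h : (reductionMap φ I n).FinitePresentation) : (RingHom.ker φ ⊔ I ^ n).FG := by
  have h1 : ((reductionMap φ I n).comp (Ideal.Quotient.mk (I ^ n))).FinitePresentation :=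
    h.comp (RingHom.FinitePresentation.of_surjective _ Ideal.Quotient.mk_surjective (by
      rw [Ideal.mk_ker]
      exact hI.pow))
  rw [reductionMap_comp_mk] at h1
  rw [← ker_mk_map_pow_comp hφ]
  algebraize [(Ideal.Quotient.mk ((I.map φ) ^ n)).comp φ]
  exact Algebra.FinitePresentation.ker_fG_of_surjective
    (Algebra.ofId A (B ⧸ (I.map φ) ^ n)) (Ideal.Quotient.mk_surjective.comp hφ)

theorem finitePresentation_reductionMap_of_fg (hφ : Function.Surjective φ) {N : Ideal A}
    (hN : N.FG) (h : N ⊔ I ^ n = RingHom.ker φ ⊔ I ^ n) :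
    (reductionMap φ I n).FinitePresentation := by
  refine RingHom.FinitePresentation.of_surjective _ (reductionMap_surjective hφ) ?_
  have h1 : (RingHom.ker (reductionMap φ I n)) = N.map (Ideal.Quotient.mk (I ^ n)) := by
    rw [← Ideal.map_comap_of_surjective _ Ideal.Quotient.mk_surjective
      (RingHom.ker (reductionMap φ I n)), comap_mk_ker_reductionMap hφ, ← h, Ideal.map_sup,
      Ideal.map_quotient_self, sup_bot_eq]
  rw [h1]
  exact hN.map _

end Reduction

/-! ### Maps out of a completion, and change of ideal. -/

section Lift

variable {A : Type u} [CommRing A] {J J' : Ideal A} {S : Type v} [CommRing S] {L : Ideal S}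

theorem pow_mul_le_comap_pow {ψ : A →+* S} {m : ℕ} (h : J ^ m ≤ L.comap ψ) (n : ℕ) :
    J ^ (m * n) ≤ (L ^ n).comap ψ := by
  rw [pow_mul]
  exact (Ideal.pow_right_mono h n).trans (Ideal.le_comap_pow ψ n)

/-- The map `lim A / J ^ k → A / J ^ (m * n) → S / L ^ n` induced by `ψ : A → S` with
`ψ (J ^ m) ⊆ L`. -/
noncomputable def adicCompletionLevelMap {ψ : A →+* S} {m : ℕ} (h : J ^ m ≤ L.comap ψ) (n : ℕ) :
    AdicCompletion J A →+* S ⧸ L ^ n :=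
  (Ideal.quotientMap (L ^ n) ψ (pow_mul_le_comap_pow h n)).comp
    (AdicCompletion.evalₐ J (m * n) : _ →+* A ⧸ J ^ (m * n))

theorem adicCompletionLevelMap_of_evalₐ_eq {ψ : A →+* S} {m : ℕ} (h : J ^ m ≤ L.comap ψ) {n : ℕ}
    {x : AdicCompletion J A} {a : A}
    (hx : AdicCompletion.evalₐ J (m * n) x = Ideal.Quotient.mk _ a) :
    adicCompletionLevelMap h n x = Ideal.Quotient.mk _ (ψ a) := by
  simp [adicCompletionLevelMap, hx]

theorem AdicCompletion.evalₐ_eq_mk_of_le {k l : ℕ} (hkl : k ≤ l) {x : AdicCompletion J A} {a : A}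
    (hx : AdicCompletion.evalₐ J l x = Ideal.Quotient.mk _ a) :
    AdicCompletion.evalₐ J k x = Ideal.Quotient.mk _ a := by
  obtain ⟨f, rfl⟩ := AdicCompletion.mk_surjective _ _ x
  rw [AdicCompletion.evalₐ_mk] at hx ⊢
  rw [← AdicCompletion.Ideal.mk_eq_mk J hkl f]
  exact Ideal.Quotient.eq.mpr (Ideal.pow_le_pow_right hkl (Ideal.Quotient.eq.mp hx))

theorem AdicCompletion.exists_evalₐ_eq_mk (x : AdicCompletion J A) (n : ℕ) :
    ∃ a, ∀ k ≤ n, AdicCompletion.evalₐ J k x = Ideal.Quotient.mk _ a := by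
  obtain ⟨a, ha⟩ := Ideal.Quotient.mk_surjective (AdicCompletion.evalₐ J n x)
  exact ⟨a, fun k hk ↦ AdicCompletion.evalₐ_eq_mk_of_le hk ha.symm⟩

theorem factorPow_comp_adicCompletionLevelMap {ψ : A →+* S} {m : ℕ} (h : J ^ m ≤ L.comap ψ)
    {k l : ℕ} (hle : k ≤ l) :
    (Ideal.Quotient.factorPow L hle).comp (adicCompletionLevelMap h l) =
      adicCompletionLevelMap h k := by
  ext x
  obtain ⟨a, ha⟩ := AdicCompletion.exists_evalₐ_eq_mk x (m * l)
  rw [RingHom.comp_apply, adicCompletionLevelMap_of_evalₐ_eq h (ha _ le_rfl),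
    adicCompletionLevelMap_of_evalₐ_eq h (ha _ (Nat.mul_le_mul_left m hle))]
  rfl

theorem exists_adicCompletion_lift [IsAdicComplete L S] {ψ : A →+* S} {m : ℕ}
    (h : J ^ m ≤ L.comap ψ) :
    ∃ θ : AdicCompletion J A →+* S, θ.comp (algebraMap A (AdicCompletion J A)) = ψ := by
  refine ⟨IsAdicComplete.liftRingHom L (adicCompletionLevelMap h)
    (factorPow_comp_adicCompletionLevelMap h), ?_⟩
  ext a
  refine (IsHausdorff.eq_iff_smodEq (I := L)).mpr fun n ↦ ?_
  rw [smul_eq_mul, Ideal.mul_top, SModEq, Ideal.Quotient.mk_eq_mk, RingHom.comp_apply,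
    IsAdicComplete.mk_liftRingHom]
  exact adicCompletionLevelMap_of_evalₐ_eq h (AdicCompletion.evalₐ_of J _ a)

theorem pow_le_comap_id {m : ℕ} (h : J ^ m ≤ J') : J ^ m ≤ J'.comap (RingHom.id A) := by
  rwa [Ideal.comap_id]

/-- The map `lim A / J ^ n → lim A / J' ^ n` for `J ^ m ≤ J'`. -/
noncomputable def adicCompletionOfPowLE {m : ℕ} (h : J ^ m ≤ J') :
    AdicCompletion J A →+* AdicCompletion J' A :=
  AdicCompletion.liftRingHom J' (adicCompletionLevelMap (pow_le_comap_id h))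
    (factorPow_comp_adicCompletionLevelMap (pow_le_comap_id h))

theorem evalₐ_adicCompletionOfPowLE {m : ℕ} (h : J ^ m ≤ J') {n : ℕ} {x : AdicCompletion J A}
    {a : A} (hx : AdicCompletion.evalₐ J (m * n) x = Ideal.Quotient.mk _ a) :
    AdicCompletion.evalₐ J' n (adicCompletionOfPowLE h x) = Ideal.Quotient.mk _ a := by
  rw [adicCompletionOfPowLE,
    AdicCompletion.evalₐ_liftRingHom J' _ (factorPow_comp_adicCompletionLevelMap _)]
  exact adicCompletionLevelMap_of_evalₐ_eq (pow_le_comap_id h) hx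

theorem adicCompletionOfPowLE_comp_apply {m n : ℕ} (h : J ^ m ≤ J') (h' : J' ^ n ≤ J)
    (x : AdicCompletion J A) :
    adicCompletionOfPowLE h' (adicCompletionOfPowLE h x) = x := by
  refine AdicCompletion.ext_evalₐ fun k ↦ ?_
  -- One representative must serve both level `k` and the level consumed by the two transports.
  obtain ⟨a, ha⟩ := AdicCompletion.exists_evalₐ_eq_mk x (max k (m * (n * k)))
  rw [ha k (le_max_left _ _)]
  exact evalₐ_adicCompletionOfPowLE h' (evalₐ_adicCompletionOfPowLE h (ha _ (le_max_right _ _)))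

/-- The completions with respect to two ideals defining the same topology are isomorphic. -/
noncomputable def adicCompletionEquiv {m n : ℕ} (h : J ^ m ≤ J') (h' : J' ^ n ≤ J) :
    AdicCompletion J A ≃+* AdicCompletion J' A :=
  RingEquiv.ofRingHom (adicCompletionOfPowLE h) (adicCompletionOfPowLE h')
    (RingHom.ext (adicCompletionOfPowLE_comp_apply h' h))
    (RingHom.ext (adicCompletionOfPowLE_comp_apply h h'))

theorem adicCompletionEquiv_comp_algebraMap {m n : ℕ} (h : J ^ m ≤ J') (h' : J' ^ n ≤ J) :
    ((adicCompletionEquiv h h' : _ →+* AdicCompletion J' A)).comp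
      (algebraMap A (AdicCompletion J A)) = algebraMap A (AdicCompletion J' A) := by
  ext1 a
  refine AdicCompletion.ext_evalₐ fun k ↦ ?_
  refine (evalₐ_adicCompletionOfPowLE h (AdicCompletion.evalₐ_of J _ a)).trans ?_
  exact (AdicCompletion.evalₐ_of J' _ a).symm

end Lift

/-! ### The completion as an adic ring. -/

section Completion

variable {A : Type u} [CommRing A] {J J' : Ideal A}

/-- Finite generation enters here: it identifies the kernels of the projections with powers of the
extended ideal. -/
theorem mem_map_algebraMap_pow_iff (hJ : J.FG) {n : ℕ} {x : AdicCompletion J A} :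
    x ∈ (J.map (algebraMap A (AdicCompletion J A))) ^ n ↔ AdicCompletion.evalₐ J n x = 0 := by
  have h := SetLike.ext_iff.mp (AdicCompletion.pow_smul_top_eq_ker_eval (M := A) (n := n) hJ) x
  rw [Ideal.smul_top_eq_map, Submodule.restrictScalars_mem, Ideal.map_pow, LinearMap.mem_ker] at h
  rw [h]
  constructor
  · intro h0
    rw [← AdicCompletion.factor_eval_eq_evalₐ J x (Ideal.mul_top _).le, h0, map_zero]
  · intro h0
    rw [← AdicCompletion.factor_evalₐ_eq_eval J x (Ideal.mul_top _).ge, h0, map_zero]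

theorem isTopologicalRing_induced_discrete {R : Type u} {S : Type v} {F : Type w} [CommRing R]
    [CommRing S] [FunLike F R S] [RingHomClass F R S] (f : F) :
    @IsTopologicalRing R (TopologicalSpace.induced f ⊥) _ := by
  let _ : TopologicalSpace S := ⊥
  have : DiscreteTopology S := ⟨rfl⟩
  let _ : TopologicalSpace R := TopologicalSpace.induced f ⊥
  have : IsTopologicalAddGroup R := topologicalAddGroup_induced f
  have : ContinuousMul R := continuousMul_induced f
  exact {}

theorem isTopologicalRing_adicCompletion (J : Ideal A) :
    IsTopologicalRing (AdicCompletion J A) := by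
  have h (n : ℕ) : @IsTopologicalRing (AdicCompletion J A)
      (TopologicalSpace.induced (AdicCompletion.evalₐ J n) ⊥) _ :=
    isTopologicalRing_induced_discrete (AdicCompletion.evalₐ J n)
  have h1 : IsTopologicalAddGroup (AdicCompletion J A) :=
    topologicalAddGroup_iInf fun n ↦ @IsTopologicalRing.to_topologicalAddGroup _ _ (_) (h n)
  have h2 : ContinuousMul (AdicCompletion J A) :=
    continuousMul_iInf fun n ↦
      (@IsTopologicalRing.toIsTopologicalSemiring _ (_) _ (h n)).toContinuousMul
  exact {}

theorem nhds_zero_adicCompletion_hasBasis (J : Ideal A) :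
    (𝓝 (0 : AdicCompletion J A)).HasBasis (fun _ : ℕ ↦ True)
      fun n ↦ {x | AdicCompletion.evalₐ J n x = 0} := by
  have h : 𝓝 (0 : AdicCompletion J A) =
      ⨅ n, Filter.principal {x | AdicCompletion.evalₐ J n x = 0} := by
    refine nhds_iInf.trans (iInf_congr fun n ↦ ?_)
    let _ : TopologicalSpace (A ⧸ J ^ n) := ⊥
    have : DiscreteTopology (A ⧸ J ^ n) := ⟨rfl⟩
    rw [nhds_induced, nhds_discrete, Filter.comap_pure, map_zero]
    rfl
  rw [h]
  refine Filter.hasBasis_iInf_principal (directed_of_isDirected_le fun k l hkl x hx ↦ ?_)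
  refine (AdicCompletion.evalₐ_eq_mk_of_le hkl (a := 0) ?_).trans (map_zero _)
  rw [map_zero]
  exact hx

variable {m n : ℕ}

theorem map_adicCompletionEquiv_map (h : J ^ m ≤ J') (h' : J' ^ n ≤ J) :
    (J'.map (algebraMap A (AdicCompletion J A))).map (adicCompletionEquiv h h') =
      J'.map (algebraMap A (AdicCompletion J' A)) := by
  rw [← adicCompletionEquiv_comp_algebraMap h h', ← Ideal.map_map]
  rfl

/-- Only `J'` is finitely generated, so membership is tested in the completion at `J'` and carried
back along the isomorphism. -/
theorem mem_map_pow_of_evalₐ_eq_zero (hJ' : J'.FG) (h : J ^ m ≤ J') (h' : J' ^ n ≤ J) {k : ℕ}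
    {x : AdicCompletion J A} (hx : AdicCompletion.evalₐ J (m * k) x = 0) :
    x ∈ (J'.map (algebraMap A (AdicCompletion J A))) ^ k := by
  have h1 : adicCompletionEquiv h h' x ∈ (J'.map (algebraMap A (AdicCompletion J' A))) ^ k := by
    rw [mem_map_algebraMap_pow_iff hJ']
    refine (evalₐ_adicCompletionOfPowLE h (a := 0) ?_).trans (map_zero _)
    rw [hx, map_zero]
  rw [← map_adicCompletionEquiv_map h h', ← Ideal.map_pow] at h1
  obtain ⟨y, hy, hyx⟩ :=
    (Ideal.mem_map_iff_of_surjective _ (adicCompletionEquiv h h').surjective).mp h1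
  rwa [← (adicCompletionEquiv h h').injective hyx]

theorem isAdicComplete_map_adicCompletion (hJ' : J'.FG) (h : J ^ m ≤ J') (h' : J' ^ n ≤ J) :
    IsAdicComplete (J'.map (algebraMap A (AdicCompletion J A))) (AdicCompletion J A) := by
  rw [← IsAdicComplete.congr_ringEquiv _ (adicCompletionEquiv h h'),
    map_adicCompletionEquiv_map]
  exact AdicCompletion.isAdicComplete_self J' hJ'

theorem isAdic_map_adicCompletion (hJ' : J'.FG) (h : J ^ m ≤ J') (h' : J' ^ n ≤ J) :
    IsAdic (J'.map (algebraMap A (AdicCompletion J A))) := by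
  have := isTopologicalRing_adicCompletion J
  refine isAdic_iff.mpr ⟨fun k ↦ ?_, fun s hs ↦ ?_⟩
  · exact ((J'.map (algebraMap A (AdicCompletion J A))) ^ k).toAddSubgroup.isOpen_of_mem_nhds
      (g := 0) (Filter.mem_of_superset
        ((nhds_zero_adicCompletion_hasBasis J).mem_of_mem (i := m * k) trivial)
        fun x hx ↦ mem_map_pow_of_evalₐ_eq_zero hJ' h h' hx)
  · obtain ⟨k, -, hk⟩ := (nhds_zero_adicCompletion_hasBasis J).mem_iff.mp hs
    refine ⟨n * k, subset_trans (fun x hx ↦ ?_) hk⟩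
    have h1 : (J'.map (algebraMap A (AdicCompletion J A))) ^ (n * k) ≤
        RingHom.ker (AdicCompletion.evalₐ J k : _ →+* A ⧸ J ^ k) := by
      rw [← Ideal.map_pow, Ideal.map_le_iff_le_comap, pow_mul]
      refine (Ideal.pow_right_mono h' k).trans fun a ha ↦ ?_
      exact (AdicCompletion.evalₐ_of J k a).trans (Ideal.Quotient.eq_zero_iff_mem.mpr ha)
    exact h1 hx

theorem exists_sub_algebraMap_mem_map_pow (hJ' : J'.FG) (h : J ^ m ≤ J') (h' : J' ^ n ≤ J)
    (x : AdicCompletion J A) (k : ℕ) :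
    ∃ a, x - algebraMap A _ a ∈ (J'.map (algebraMap A (AdicCompletion J A))) ^ k := by
  obtain ⟨a, ha⟩ := Ideal.Quotient.mk_surjective (AdicCompletion.evalₐ J (m * k) x)
  refine ⟨a, mem_map_pow_of_evalₐ_eq_zero hJ' h h' ?_⟩
  rw [map_sub, ← ha, sub_eq_zero]
  exact (AdicCompletion.evalₐ_of J _ a).symm

end Completion

/-! ### The kernel of a factorisation through a ring in which `A` is dense. -/

section Dense

variable {A : Type u} {B : Type v} {E : Type w} [CommRing A] [CommRing B] [CommRing E]
  {φ : A →+* B} {ι : A →+* E} {φhat : E →+* B} {I : Ideal A}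

theorem map_map_sup_ker_eq (hfac : φhat.comp ι = φ) (I : Ideal A) :
    ((I ⊔ RingHom.ker φ).map ι).map φhat = I.map φ := by
  rw [Ideal.map_map, hfac, Ideal.map_sup, (Ideal.map_eq_bot_iff_le_ker φ).mpr le_rfl, sup_bot_eq]

theorem ker_le_map_sup (hφ : Function.Surjective φ) (hfac : φhat.comp ι = φ)
    (hι : ∀ x k, ∃ a, x - ι a ∈ ((I ⊔ RingHom.ker φ).map ι) ^ k) (k : ℕ) :
    RingHom.ker φhat ≤ (RingHom.ker φ ⊔ (I ⊔ RingHom.ker φ) ^ k).map ι := by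
  intro x hx
  obtain ⟨a, ha⟩ := hι x k
  have h1 : φhat (x - ι a) ∈ (I.map φ) ^ k := by
    rw [← map_map_sup_ker_eq hfac I, ← Ideal.map_pow]
    exact Ideal.mem_map_of_mem _ ha
  have h2 : φ a ∈ (I.map φ) ^ k := by
    have e : φhat (ι a) = φ a := RingHom.congr_fun hfac a
    rw [map_sub, (RingHom.mem_ker).mp hx, zero_sub, e] at h1
    simpa using neg_mem h1
  have h3 : a ∈ RingHom.ker φ ⊔ (I ⊔ RingHom.ker φ) ^ k := by
    have : a ∈ RingHom.ker φ ⊔ I ^ k := by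
      rw [← ker_mk_map_pow_comp hφ]
      exact Ideal.Quotient.eq_zero_iff_mem.mpr h2
    exact (sup_le_sup_left (Ideal.pow_right_mono (le_sup_left : I ≤ I ⊔ RingHom.ker φ) k)
      (RingHom.ker φ)) this
  rw [← sub_add_cancel x (ι a)]
  refine add_mem ?_ (Ideal.mem_map_of_mem ι h3)
  rw [← Ideal.map_pow] at ha
  exact Ideal.map_mono le_sup_right ha

end Dense

/-! ### Topological nilpotence, density and the properties of `φhat`. -/

section Neighbourhood

theorem exists_pow_le_comap_of_topologicallyNilpotent {A : Type u} {S : Type v} [CommRing A]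
    [CommRing S] [TopologicalSpace S] {J : Ideal A} (hJ : J.FG) {L : Ideal S} (hL : IsAdic L)
    {ψ : A →+* S} (h : ∀ a ∈ J, IsTopologicallyNilpotent (ψ a)) : ∃ m : ℕ, J ^ m ≤ L.comap ψ := by
  refine Ideal.exists_pow_le_of_le_radical_of_fg (fun a ha ↦ ?_) hJ
  obtain ⟨k, hk⟩ := (h a ha).exists_pow_mem_of_mem_nhds (hL.mem_nhds_zero 1)
  refine ⟨k, ?_⟩
  rw [Ideal.mem_comap, map_pow]
  simpa using hk

theorem isTopologicallyNilpotent_of_mem_sup_ker {A : Type u} {B : Type v} [CommRing A]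
    [TopologicalSpace A] [CommRing B] {φ : A →+* B} {I : Ideal A}
    {C' : Type w₁} {C : Type w₂} [CommRing C'] [TopologicalSpace C']
    [CommRing C] [TopologicalSpace C] {φ' : C' →+* C}
    (hφ' : IsThickening φ') {ψ : A →+* C'} {ψ' : B →+* C} (hψ : Continuous ψ) (h : φ'.comp ψ = ψ'.comp φ)
    (hI : IsAdic I) {a : A} (ha : a ∈ I ⊔ RingHom.ker φ) : IsTopologicallyNilpotent (ψ a) := by
  obtain ⟨L, -, hL, -⟩ := hφ'.isAdicRing_source.exists_ideal
  have := hL.isTopologicalRing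
  have : IsLinearTopology C' C' := by
    have h0 := L.isLinearTopology
    rwa [← (show _ = L.adicTopology from hL)] at h0
  obtain ⟨b, hb, c, hc, rfl⟩ := Submodule.mem_sup.mp ha
  rw [map_add]
  refine IsTopologicallyNilpotent.add ?_ ?_
  · exact (hI.isTopologicallyNilpotent hb).map hψ
  · refine hφ'.isTopologicallyNilpotent _ ?_
    have e : φ' (ψ c) = ψ' (φ c) := RingHom.congr_fun h c
    rw [RingHom.mem_ker, e, (RingHom.mem_ker).mp hc, map_zero]

/-- Continuous homomorphisms out of an adic ring, into a separated ring, are equal if they agree on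
a dense subring. -/
theorem eq_of_comp_eq_of_dense {A : Type u} {E : Type v} {S : Type w} [CommRing A] [CommRing E]
    [TopologicalSpace E] [CommRing S] [TopologicalSpace S] {F : Ideal E} (hF : IsAdic F)
    {L : Ideal S} (hL : IsAdic L) [IsHausdorff L S] {ι : A →+* E}
    (hι : ∀ x k, ∃ a, x - ι a ∈ F ^ k) {f g : E →+* S} (hf : Continuous f) (hg : Continuous g)
    (h : f.comp ι = g.comp ι) : f = g := by
  ext x
  refine (IsHausdorff.eq_iff_smodEq (I := L)).mpr fun n ↦ ?_
  rw [smul_eq_mul, Ideal.mul_top, SModEq.sub_mem]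
  obtain ⟨m₁, h₁⟩ := hF.exists_pow_le_comap hL hf
  obtain ⟨m₂, h₂⟩ := hF.exists_pow_le_comap hL hg
  obtain ⟨a, ha⟩ := hι x (max (m₁ * n) (m₂ * n))
  have hfx : f (x - ι a) ∈ L ^ n :=
    pow_mul_le_comap_pow h₁ n (Ideal.pow_le_pow_right (le_max_left _ _) ha)
  have hgx : g (x - ι a) ∈ L ^ n :=
    pow_mul_le_comap_pow h₂ n (Ideal.pow_le_pow_right (le_max_right _ _) ha)
  have e : f (ι a) = g (ι a) := RingHom.congr_fun h a
  have := sub_mem hfx hgx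
  rwa [map_sub, map_sub, e, sub_sub_sub_cancel_right] at this

variable {A : Type u} {B : Type v} [CommRing A] [TopologicalSpace A] [CommRing B]
  [TopologicalSpace B]

theorem infinitesimalNeighbourhoodMap_comp_algebraMap (hB : IsAdicRing B) (φ : A →+* B)
    (hφ : IsAdicHom φ) (I : Ideal A) (hI : IsAdic I) :
    (infinitesimalNeighbourhoodMap hB φ hφ I hI).comp
      (algebraMap A (AdicCompletion (I ⊔ RingHom.ker φ) A)) = φ := by
  have := hB.isAdicComplete (hφ.isAdic_map I hI)
  ext a
  refine (IsHausdorff.eq_iff_smodEq (I := I.map φ)).mpr fun n ↦ ?_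
  rw [smul_eq_mul, Ideal.mul_top, SModEq, Ideal.Quotient.mk_eq_mk, RingHom.comp_apply,
    infinitesimalNeighbourhoodMap, IsAdicComplete.mk_liftRingHom,
    infinitesimalNeighbourhoodLevelMap, RingHom.comp_apply]
  refine (congrArg _ (AdicCompletion.evalₐ_of _ n a)).trans ?_
  rw [Ideal.quotientMap_mk]
  rfl

variable {E : Type w} [CommRing E] [TopologicalSpace E] {φ : A →+* B} {ι : A →+* E}
  {φhat : E →+* B} {I : Ideal A}

theorem isOfFormalFinitePresentation_of_dense (hI : IsAdic I) (hφ : IsAdicHom φ)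
    (hsurj : Function.Surjective φ) (hfac : φhat.comp ι = φ)
    (hF : IsAdic ((I ⊔ RingHom.ker φ).map ι))
    (hι : ∀ x k, ∃ a, x - ι a ∈ ((I ⊔ RingHom.ker φ).map ι) ^ k)
    (hfg : (I ⊔ RingHom.ker φ).FG) (hfgn : ∀ k, (RingHom.ker φ ⊔ I ^ (k + 1)).FG) :
    IsOfFormalFinitePresentation φhat where
  toIsAdicHom := IsAdicHom.of_isAdic_map hF (by
    rw [map_map_sup_ker_eq hfac]
    exact hφ.isAdic_map I hI)
  finitePresentation L hL n := by
    have hs : Function.Surjective φhat := by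
      rw [← hfac, RingHom.coe_comp] at hsurj
      exact hsurj.of_comp
    obtain ⟨m, hm⟩ := hF.exists_pow_le hL
    -- The extra `+ 1` keeps the exponent positive, as `hfgn` only covers positive powers.
    have hk : ((I ⊔ RingHom.ker φ).map ι) ^ (m * (n + 1) + 1) ≤ L ^ (n + 1) := by
      refine (Ideal.pow_le_pow_right (Nat.le_succ _)).trans ?_
      rw [pow_mul]
      exact Ideal.pow_right_mono hm _
    generalize m * (n + 1) = k at hk
    refine finitePresentation_reductionMap_of_fg hs
      (N := (RingHom.ker φ ⊔ (I ⊔ RingHom.ker φ) ^ (k + 1)).map ι) (Ideal.FG.map ?_ _) ?_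
    -- `K` alone may not be finitely generated; absorbing `I ^ (k + 1)` gives a sum of two ideals
    -- that are.
    · have e : RingHom.ker φ ⊔ (I ⊔ RingHom.ker φ) ^ (k + 1) =
          (RingHom.ker φ ⊔ I ^ (k + 1)) ⊔ (I ⊔ RingHom.ker φ) ^ (k + 1) := by
        rw [sup_assoc, sup_eq_right.mpr
          (Ideal.pow_right_mono (le_sup_left : I ≤ I ⊔ RingHom.ker φ) (k + 1))]
      rw [e]
      exact Submodule.FG.sup (hfgn k) hfg.pow
    · refine le_antisymm (sup_le ?_ le_sup_right)
        (sup_le_sup_right (ker_le_map_sup hsurj hfac hι (k + 1)) _)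
      rw [Ideal.map_sup, Ideal.map_pow]
      refine sup_le_sup ?_ hk
      rw [Ideal.map_le_iff_le_comap, RingHom.comap_ker, hfac]

theorem isThickening_of_dense (hI : IsAdic I) (hB : IsAdicRing B) (hφ : IsAdicHom φ)
    (hsurj : Function.Surjective φ) (hfac : φhat.comp ι = φ)
    (hF : IsAdic ((I ⊔ RingHom.ker φ).map ι)) (hE : IsAdicRing E)
    (hι : ∀ x k, ∃ a, x - ι a ∈ ((I ⊔ RingHom.ker φ).map ι) ^ k) :
    IsThickening φhat where
  toIsAdicHom := IsAdicHom.of_isAdic_map hF (by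
    rw [map_map_sup_ker_eq hfac]
    exact hφ.isAdic_map I hI)
  isAdicRing_source := hE
  isAdicRing_target := hB
  surjective := by
    rw [← hfac, RingHom.coe_comp] at hsurj
    exact hsurj.of_comp
  isTopologicallyNilpotent x hx := by
    refine hF.isTopologicallyNilpotent ?_
    have := ker_le_map_sup hsurj hfac hι 1 hx
    rwa [pow_one, sup_eq_right.mpr le_sup_right] at this

end Neighbourhood

theorem mainTheorem2 {A : Type u} {B : Type v} [CommRing A] [TopologicalSpace A] [CommRing B]
    [TopologicalSpace B] (hA : IsAdicRing A) (hB : IsAdicRing B) (φ : A →+* B)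
    (hsurj : Function.Surjective φ) (hφ : IsOfFormalFinitePresentation φ)
    (I : Ideal A) (hI : IsAdic I) :
    IsOfFormalFinitePresentation (infinitesimalNeighbourhoodMap hB φ hφ.toIsAdicHom I hI) ∧
    IsAffineInfinitesimalNeighbourhood.{u, v, u, w₁, w₂} φ
      (algebraMap A (AdicCompletion (I ⊔ RingHom.ker φ) A))
      (infinitesimalNeighbourhoodMap hB φ hφ.toIsAdicHom I hI) := by
  obtain ⟨I₀, hfg₀, hI₀, -⟩ := hA.exists_ideal
  have hfgn (k : ℕ) : (RingHom.ker φ ⊔ I₀ ^ (k + 1)).FG :=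
    fg_ker_sup_pow_of_finitePresentation hsurj hfg₀ (hφ.finitePresentation I₀ hI₀ k)
  have hfg : (I₀ ⊔ RingHom.ker φ).FG := by
    simpa [sup_comm] using hfgn 0
  have hcofinal {I J : Ideal A} (hI : IsAdic I) (hJ : IsAdic J) :
      ∃ m : ℕ, (I ⊔ RingHom.ker φ) ^ m ≤ J ⊔ RingHom.ker φ := by
    obtain ⟨m, hm⟩ := hI.exists_pow_le hJ
    -- A product of `m + 1` factors from `I` and `K` has `m` factors in `I` or at least one in `K`.
    refine ⟨m + 1, Ideal.sup_pow_add_le_pow_sup_pow.trans ?_⟩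
    rw [pow_one]
    exact sup_le_sup_right hm _
  obtain ⟨m, hm⟩ := hcofinal hI hI₀
  obtain ⟨n, hn⟩ := hcofinal hI₀ hI
  have hF := isAdic_map_adicCompletion hfg hm hn
  have hι := exists_sub_algebraMap_mem_map_pow hfg hm hn
  have hE : IsAdicRing (AdicCompletion (I ⊔ RingHom.ker φ) A) :=
    ⟨_, hfg.map _, hF, isAdicComplete_map_adicCompletion hfg hm hn⟩
  have hfac := infinitesimalNeighbourhoodMap_comp_algebraMap hB φ hφ.toIsAdicHom I hI
  have hthick := isThickening_of_dense hI₀ hB hφ.toIsAdicHom hsurj hfac hF hE hι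
  refine ⟨isOfFormalFinitePresentation_of_dense hI₀ hφ.toIsAdicHom hsurj hfac hF hι hfg hfgn,
    ?_, hthick, hfac, ?_⟩
  · refine hI₀.continuous_of_pow_le_comap hF (m := 1) ?_
    rw [pow_one]
    exact le_sup_left.trans Ideal.le_comap_map
  · intro C' C _ _ _ _ φ' hφ' ψ ψ' hψ hψ' hcomm
    obtain ⟨L, -, hL, hLc⟩ := hφ'.isAdicRing_source.exists_ideal
    obtain ⟨L', -, hL', hLc'⟩ := hφ'.isAdicRing_target.exists_ideal
    obtain ⟨l, hl⟩ := exists_pow_le_comap_of_topologicallyNilpotent hfg hL (ψ := ψ) fun a ha ↦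
      isTopologicallyNilpotent_of_mem_sup_ker hφ' hψ hcomm hI₀ ha
    -- The completion is formed at `I + K`, so the bound for `I₀ + K` is transferred.
    have hl' : (I ⊔ RingHom.ker φ) ^ (m * l) ≤ L.comap ψ := by
      rw [pow_mul]
      exact (Ideal.pow_right_mono hm l).trans hl
    obtain ⟨θ, hθ⟩ := exists_adicCompletion_lift hl'
    have hθc : Continuous θ := by
      refine hF.continuous_of_pow_le_comap hL (m := l) ?_
      rw [← Ideal.map_pow, Ideal.map_le_iff_le_comap, Ideal.comap_comap, hθ]
      exact hl
    refine ⟨θ, ⟨hθc, hθ, ?_⟩, fun θ' hθ' ↦ ?_⟩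
    · refine eq_of_comp_eq_of_dense hF hL' hι (hφ'.continuous.comp hθc)
        (hψ'.comp hthick.continuous) ?_
      rw [RingHom.comp_assoc, hθ, RingHom.comp_assoc, hfac, hcomm]
    · exact eq_of_comp_eq_of_dense hF hL hι hθ'.1 hθc (hθ'.2.1.trans hθ.symm)
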